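/- Let $\mathcal H$ be a real reproducing kernel Hilbert space of functions on a set $\mathcal X$, with reproducing kernel $k$. Let $n\ge 1$, let $x_1,\dots,x_n\in\mathcal X$ be deterministic, let $f^\star\in\mathcal H$, and let $y_i=f^\star(x_i)+\varepsilon_i$ for $i=1,\dots,n$. Assume that the noise variables $\varepsilon_1,\dots,\varepsilon_n$ are independent and $\sigma$-sub-Gaussian for some $\sigma\ge 0$, i.e. $\mathbb E[e^{t\varepsilon_i}]\le e^{\sigma^2t^2/2}$ for all $t\in\mathbb R$ and all $i$, and that the kernel matrix $K_n=(k(x_i,x_j))_{i,j=1}^n$ is (strictly) positive definite. For $\alpha>0$ let $P_\alpha=\mathcal N(0,\alpha K_n)$ be the law on $\mathbb R^n$ of the values at $x_1,\dots,x_n$ of a centred Gaussian process with covariance function $\alpha k$, and for $\eta>0$ let $Q_{n,\eta,\alpha}$ be the (random) Gibbs posterior, the probability measure on $\mathbb R^n$ with $$\frac{\mathrm dQ_{n,\eta,\alpha}}{\mathrm dP_\alpha}(g)\;\propto\;\exp\Big(-\eta\sum_{i=1}^n (g_i-y_i)^2\Big).$$ For $g\in\mathbb R^n$ let $R_n(g)=\frac1n\sum_{i=1}^n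 (g_i-f^\star(x_i))^2$ be the fixed-design excess risk. For $s\ge 0$ let $\gamma_n(s)=\frac12\log\det(sK_n+I)$ be the information gain, and for $s>t\ge 0$ let $\gamma_n(s,t)=\gamma_n(s)-\gamma_n(t)$ be the relative information gain. **Theorem.** For every $\delta\in(0,1]$, every $\eta\in(0,\frac1{2\sigma^2})$ (where $\frac{1}{2\sigma^2}=+\infty$ if $\sigma=0$), every $\beta>0$ such that $\eta-2\sigma^2\eta^2-\beta-2\sigma^2\beta^2>0$, and every $\alpha>0$, with probability at least $1-\delta$ the excess risk $R_n$ is $Q_{n,\eta,\alpha}$-integrable and $$\int R_n(g)\,\mathrm dQ_{n,\eta,\alpha}(g)\;\le\;\frac{2\gamma_n(2\eta\alpha,2\beta\alpha)+\frac1{2\alpha}\|f^\star\|_{\mathcal H}^2+2\log\frac1\delta}{n\,(\eta-2\sigma^2\eta^2-\beta-2\sigma^2\beta^2)}.$$ -/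

import Mathlib

open MeasureTheory ProbabilityTheory
open scoped NNReal ENNReal Matrix

noncomputable section

namespace GPRegression

/-- The real-valued reproducing kernel `k(x, x')` of a (real, scalar) RKHS `H` of functions on `X`.
Mathlib's kernel takes values in the continuous linear maps `ℝ →L[ℝ] ℝ`; evaluating at `1`
identifies these with real numbers. -/
def scalarKernel {X : Type*} (H : Type*) [NormedAddCommGroup H] [InnerProductSpace ℝ H]
    [CompleteSpace H] [RKHS ℝ H X ℝ] (x x' : X) : ℝ :=
  RKHS.kernel H x x' 1

/-- The kernel matrix `K_n = (k(x_i, x_j))_{i,j}`. -/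
def kernelMatrix {X : Type*} (H : Type*) [NormedAddCommGroup H] [InnerProductSpace ℝ H]
    [CompleteSpace H] [RKHS ℝ H X ℝ] {n : ℕ} (x : Fin n → X) : Matrix (Fin n) (Fin n) ℝ :=
  Matrix.of fun i j => scalarKernel H (x i) (x j)

/-- The information gain `γ_n(η) = (1/2) log det(η K_n + I)`. -/
def infoGain {n : ℕ} (K : Matrix (Fin n) (Fin n) ℝ) (η : ℝ) : ℝ :=
  (1 / 2 : ℝ) * Real.log (η • K + 1).det

/-- The relative information gain `γ_n(η, β) = γ_n(η) - γ_n(β)`. -/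
def relInfoGain {n : ℕ} (K : Matrix (Fin n) (Fin n) ℝ) (η β : ℝ) : ℝ :=
  infoGain K η - infoGain K β

/-- The marginal at the design points of the Gaussian process prior with mean zero and covariance
function `α k`, i.e. the Gaussian distribution `N(0, α K_n)` on `ℝⁿ`. -/
def gpPrior {n : ℕ} (K : Matrix (Fin n) (Fin n) ℝ) (α : ℝ) :
    Measure (EuclideanSpace ℝ (Fin n)) :=
  multivariateGaussian 0 (α • K)

/-- The Gibbs posterior `Q_{n,η,α}` on `ℝⁿ`: the probability measure with
`dQ/dP_α (g) ∝ exp(-η ∑ i, (g_i - y_i)²)`. -/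
def gibbsPosterior {n : ℕ} (K : Matrix (Fin n) (Fin n) ℝ) (y : Fin n → ℝ) (η α : ℝ) :
    Measure (EuclideanSpace ℝ (Fin n)) :=
  (gpPrior K α).tilted fun g => -η * ∑ i, (g i - y i) ^ 2

/-- The density is bounded for `η ≥ 0`, so the Gibbs posterior is a genuine probability measure. -/
theorem isProbabilityMeasure_gibbsPosterior {n : ℕ} (K : Matrix (Fin n) (Fin n) ℝ)
    (y : Fin n → ℝ) {η : ℝ} (hη : 0 ≤ η) (α : ℝ) :
    IsProbabilityMeasure (gibbsPosterior K y η α) := by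
  have : IsProbabilityMeasure (gpPrior K α) := by unfold gpPrior; infer_instance
  refine isProbabilityMeasure_tilted ?_
  refine Integrable.of_bound (C := 1) (Continuous.aestronglyMeasurable (by fun_prop)) ?_
  filter_upwards with g
  rw [Real.norm_eq_abs, abs_of_pos (Real.exp_pos _), Real.exp_le_one_iff]
  have : 0 ≤ ∑ i, (g i - y i) ^ 2 := Finset.sum_nonneg fun i _ => sq_nonneg _
  nlinarith

/-- The (fixed design) excess risk `R_n(g) = (1/n) ‖g - f‖₂²`, where `f` is the vector of
values of the target function at the design points. -/
def excessRisk {n : ℕ} (f : Fin n → ℝ) (g : EuclideanSpace ℝ (Fin n)) : ℝ :=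
  (1 / (n : ℝ)) * ‖g - WithLp.toLp 2 f‖ ^ 2

end GPRegression

end

/-! Let r = n R_n, and let V be the empirical loss minus the sum of the ε_i². Then V is r minus a
term linear in the noise, so sub-Gaussianity bounds its exponential moments of both signs by
exponentials of multiples of r.

Put c = η - 2σ²η², a = β + 2σ²β², N = ∫ exp(-a r) dP_α and Z_s = ∫ exp(-s V) dP_α. The random
integrals A of exp(-ηV + (c-a) r) and B of exp(βV - 2a r) both have expectation at most N, so
Markov's inequality gives A + B < 2N/δ with the required probability. Donsker-Varadhan bounds (c-a)
∫ r dQ by log A - log Z_η. Cauchy-Schwarz gives N² ≤ Z_β B, and AM-GM gives AB ≤ (N/δ)², so the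
intractable N cancels and A ≤ Z_β/δ² (`ofReal_le_measure_localized_pacBayes`).

It remains to bound log Z_β - log Z_η (`log_integral_exp_sub_le`). In an eigenbasis of K_n both
integrals are products of one-dimensional Gaussian integrals. The determinants give the relative
information gain; a scalar inequality in each coordinate cancels the noise against the subtracted
ε_i² and leaves a sum that Bessel's inequality in H bounds by the RKHS norm. -/

namespace GPRegression

/-! ### Localized PAC-Bayes bound -/

section PACBayes

variable {E Ω : Type*} [MeasurableSpace E] [MeasurableSpace Ω]

/-- The Donsker-Varadhan bound for the mean of a nonnegative function under a tilted measure. -/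
theorem integrable_tilted_and_mul_integral_le {μ : Measure E} [IsProbabilityMeasure μ]
    {u r : E → ℝ} (hr : Measurable r) (hr0 : ∀ g, 0 ≤ r g) {κ : ℝ} (hκ : 0 < κ)
    (hu : Integrable (fun g => Real.exp (u g)) μ)
    (hur : Integrable (fun g => Real.exp (u g + κ * r g)) μ) :
    Integrable r (μ.tilted u) ∧
      κ * ∫ g, r g ∂(μ.tilted u) ≤
        Real.log (∫ g, Real.exp (u g + κ * r g) ∂μ) - Real.log (∫ g, Real.exp (u g) ∂μ) := by
  have hprob : IsProbabilityMeasure (μ.tilted u) := isProbabilityMeasure_tilted hu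
  have hexp : Integrable (fun g => Real.exp (κ * r g)) (μ.tilted u) := by
    rw [integrable_tilted_iff hu]
    simpa [← Real.exp_add] using hur
  have hκr : Integrable (fun g => κ * r g) (μ.tilted u) := by
    refine hexp.mono' (by fun_prop) (ae_of_all _ fun g => ?_)
    rw [Real.norm_eq_abs, abs_of_nonneg (mul_nonneg hκ.le (hr0 g))]
    linarith [Real.add_one_le_exp (κ * r g)]
  have hrint : Integrable r (μ.tilted u) := by
    have := hκr.const_mul κ⁻¹
    simpa [inv_mul_cancel_left₀ hκ.ne'] using this
  refine ⟨hrint, ?_⟩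
  have hjensen : Real.exp (∫ g, κ * r g ∂(μ.tilted u)) ≤ ∫ g, Real.exp (κ * r g) ∂(μ.tilted u) :=
    convexOn_exp.map_integral_le Real.continuous_exp.continuousOn isClosed_univ
      (ae_of_all _ fun _ => Set.mem_univ _) hκr hexp
  rw [integral_exp_tilted, integral_const_mul] at hjensen
  have hpos₁ : 0 < ∫ g, Real.exp (u g) ∂μ := integral_exp_pos hu
  have hpos₂ : 0 < ∫ g, Real.exp (u g + κ * r g) ∂μ := integral_exp_pos hur
  rw [← Real.log_div hpos₂.ne' hpos₁.ne', Real.le_log_iff_exp_le (div_pos hpos₂ hpos₁)]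
  exact hjensen

/-- The Cauchy-Schwarz inequality for integrals of exponentials. -/
theorem sq_integral_exp_le {μ : Measure E} [IsProbabilityMeasure μ] {p q w : E → ℝ}
    (hw : ∀ g, 2 * w g = p g + q g)
    (hpi : Integrable (fun g => Real.exp (p g)) μ) (hqi : Integrable (fun g => Real.exp (q g)) μ)
    (hwi : Integrable (fun g => Real.exp (w g)) μ) :
    (∫ g, Real.exp (w g) ∂μ) ^ 2 ≤ (∫ g, Real.exp (p g) ∂μ) * ∫ g, Real.exp (q g) ∂μ := by
  have hp0 : 0 < ∫ g, Real.exp (p g) ∂μ := integral_exp_pos hpi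
  have hw0 : 0 < ∫ g, Real.exp (w g) ∂μ := integral_exp_pos hwi
  set Z := ∫ g, Real.exp (p g) ∂μ
  set N := ∫ g, Real.exp (w g) ∂μ
  -- AM-GM with the weight N / Z, chosen so that the first term integrates to exactly N.
  have hpoint (g : E) :
      2 * Real.exp (w g) ≤ N / Z * Real.exp (p g) + Z / N * Real.exp (q g) := by
    have hsq : Real.exp (w g) ^ 2 = Real.exp (p g) * Real.exp (q g) := by
      rw [sq, ← Real.exp_add, ← Real.exp_add, ← hw g, two_mul]
    have hNp : 0 < N / Z * Real.exp (p g) := by positivity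
    have hZq : 0 < Z / N * Real.exp (q g) := by positivity
    have hmul : N / Z * Real.exp (p g) * (Z / N * Real.exp (q g)) = Real.exp (w g) ^ 2 := by
      rw [hsq]; field_simp
    refine le_of_sq_le_sq ?_ (by positivity)
    nlinarith [sq_nonneg (N / Z * Real.exp (p g) - Z / N * Real.exp (q g))]
  have hint := integral_mono (hwi.const_mul 2)
    ((hpi.const_mul (N / Z)).add (hqi.const_mul (Z / N))) hpoint
  simp only [Pi.add_apply] at hint
  rw [integral_add (hpi.const_mul _) (hqi.const_mul _), integral_const_mul, integral_const_mul,
    integral_const_mul, div_mul_cancel₀ _ hp0.ne'] at hint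
  have hN : N ≤ Z / N * ∫ g, Real.exp (q g) ∂μ := by linarith
  calc N ^ 2 = N * N := sq N
    _ ≤ (Z / N * ∫ g, Real.exp (q g) ∂μ) * N := by gcongr
    _ = Z * ∫ g, Real.exp (q g) ∂μ := by field_simp

/-- Tonelli's theorem for a weighted average of exponential moments. -/
theorem lintegral_lintegral_exp_le {μ : Measure E} [IsProbabilityMeasure μ] {P : Measure Ω}
    [IsProbabilityMeasure P] {W : Ω → E → ℝ} {s : E → ℝ} (hW : Measurable (Function.uncurry W))
    (hs : Integrable (fun g => Real.exp (s g)) μ)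
    (hWs : ∀ g, ∫⁻ ω, ENNReal.ofReal (Real.exp (W ω g)) ∂P ≤ ENNReal.ofReal (Real.exp (s g))) :
    ∫⁻ ω, ∫⁻ g, ENNReal.ofReal (Real.exp (W ω g)) ∂μ ∂P ≤
      ENNReal.ofReal (∫ g, Real.exp (s g) ∂μ) := by
  rw [lintegral_lintegral_swap (by
    exact (ENNReal.measurable_ofReal.comp (Real.measurable_exp.comp hW)).aemeasurable),
    ofReal_integral_eq_lintegral_ofReal hs (ae_of_all _ fun _ => (Real.exp_pos _).le)]
  exact lintegral_mono hWs

/-- A localized PAC-Bayes bound for Gibbs posteriors. -/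
theorem ofReal_le_measure_localized_pacBayes {μ : Measure E} [IsProbabilityMeasure μ]
    {P : Measure Ω} [IsProbabilityMeasure P] {V : Ω → E → ℝ} {r : E → ℝ}
    (hV : Measurable (Function.uncurry V)) (hr : Measurable r) (hr0 : ∀ g, 0 ≤ r g)
    {η β a c δ : ℝ} (ha : 0 ≤ a) (hac : a < c) (hδ0 : 0 < δ)
    (hη : ∀ ω, Integrable (fun g => Real.exp (-η * V ω g)) μ)
    (hβ : ∀ ω, Integrable (fun g => Real.exp (-β * V ω g)) μ)
    (hmgf₁ : ∀ g, ∫⁻ ω, ENNReal.ofReal (Real.exp (-η * V ω g + (c - a) * r g)) ∂P ≤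
      ENNReal.ofReal (Real.exp (-a * r g)))
    (hmgf₂ : ∀ g, ∫⁻ ω, ENNReal.ofReal (Real.exp (β * V ω g - 2 * a * r g)) ∂P ≤
      ENNReal.ofReal (Real.exp (-a * r g))) :
    ENNReal.ofReal (1 - δ) ≤ P {ω | Integrable r (μ.tilted fun g => -η * V ω g) ∧
      (c - a) * ∫ g, r g ∂(μ.tilted fun g => -η * V ω g) ≤
        Real.log (∫ g, Real.exp (-β * V ω g) ∂μ) - Real.log (∫ g, Real.exp (-η * V ω g) ∂μ)
          + 2 * Real.log (1 / δ)} := by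
  have hN : Integrable (fun g => Real.exp (-a * r g)) μ := by
    refine Integrable.of_bound (C := 1) (by fun_prop) (ae_of_all _ fun g => ?_)
    rw [Real.norm_eq_abs, abs_of_pos (Real.exp_pos _), Real.exp_le_one_iff]
    nlinarith [hr0 g]
  have hN0 : 0 < ∫ g, Real.exp (-a * r g) ∂μ := integral_exp_pos hN
  set N := ∫ g, Real.exp (-a * r g) ∂μ with hNdef
  have hVω (ω : Ω) : Measurable (V ω) := hV.comp measurable_prodMk_left
  have hW₁ : Measurable (Function.uncurry fun ω g => -η * V ω g + (c - a) * r g) :=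
    (hV.const_mul _).add ((hr.comp measurable_snd).const_mul _)
  have hW₂ : Measurable (Function.uncurry fun ω g => β * V ω g - 2 * a * r g) :=
    (hV.const_mul _).sub ((hr.comp measurable_snd).const_mul _)
  let A : Ω → ℝ≥0∞ := fun ω => ∫⁻ g, ENNReal.ofReal (Real.exp (-η * V ω g + (c - a) * r g)) ∂μ
  let B : Ω → ℝ≥0∞ := fun ω => ∫⁻ g, ENNReal.ofReal (Real.exp (β * V ω g - 2 * a * r g)) ∂μ
  have hA : Measurable A := Measurable.lintegral_prod_right'
    (ENNReal.measurable_ofReal.comp (Real.measurable_exp.comp hW₁))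
  have hB : Measurable B := Measurable.lintegral_prod_right'
    (ENNReal.measurable_ofReal.comp (Real.measurable_exp.comp hW₂))
  have hAB : ∫⁻ ω, (A ω + B ω) ∂P ≤ ENNReal.ofReal (2 * N) := by
    rw [lintegral_add_left hA, two_mul, ENNReal.ofReal_add hN0.le hN0.le]
    exact add_le_add (lintegral_lintegral_exp_le hW₁ hN hmgf₁)
      (lintegral_lintegral_exp_le hW₂ hN hmgf₂)
  -- One Markov bound for the sum, instead of a union bound over `A` and `B`, avoids an extra log 2.
  have hmarkov : P {ω | ENNReal.ofReal (2 * N / δ) ≤ A ω + B ω} ≤ ENNReal.ofReal δ := by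
    have hpos : 0 < 2 * N / δ := by positivity
    calc P {ω | ENNReal.ofReal (2 * N / δ) ≤ A ω + B ω}
        ≤ (∫⁻ ω, (A ω + B ω) ∂P) / ENNReal.ofReal (2 * N / δ) :=
          meas_ge_le_lintegral_div (hA.add hB).aemeasurable (by simpa using hpos)
            ENNReal.ofReal_ne_top
      _ ≤ ENNReal.ofReal (2 * N) / ENNReal.ofReal (2 * N / δ) := by gcongr
      _ = ENNReal.ofReal δ := by
          rw [← ENNReal.ofReal_div_of_pos hpos]
          congr 1
          field_simp
  have hmeas : MeasurableSet {ω | ENNReal.ofReal (2 * N / δ) ≤ A ω + B ω} :=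
    measurableSet_le measurable_const (hA.add hB)
  calc ENNReal.ofReal (1 - δ) = 1 - ENNReal.ofReal δ := by
        rw [ENNReal.ofReal_sub _ hδ0.le, ENNReal.ofReal_one]
    _ ≤ 1 - P {ω | ENNReal.ofReal (2 * N / δ) ≤ A ω + B ω} := by gcongr
    _ = P {ω | ENNReal.ofReal (2 * N / δ) ≤ A ω + B ω}ᶜ := (prob_compl_eq_one_sub hmeas).symm
    _ ≤ _ := by
      refine measure_mono fun ω hω => ?_
      simp only [Set.mem_compl_iff, Set.mem_ofPred_eq, not_le] at hω
      -- Integrability is not known for every ω; it comes from finiteness of `A ω` and `B ω` off the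
      -- bad event.
      have hAi : Integrable (fun g => Real.exp (-η * V ω g + (c - a) * r g)) μ := by
        have := hVω ω
        refine (lintegral_ofReal_ne_top_iff_integrable (by fun_prop)
          (ae_of_all _ fun _ => (Real.exp_pos _).le)).1 ?_
        exact ((le_self_add.trans_lt hω).trans ENNReal.ofReal_lt_top).ne
      have hBi : Integrable (fun g => Real.exp (β * V ω g - 2 * a * r g)) μ := by
        have := hVω ω
        refine (lintegral_ofReal_ne_top_iff_integrable (by fun_prop)
          (ae_of_all _ fun _ => (Real.exp_pos _).le)).1 ?_
        exact ((le_add_self.trans_lt hω).trans ENNReal.ofReal_lt_top).ne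
      have hA0 := integral_exp_pos hAi
      have hB0 := integral_exp_pos hBi
      have hsum : (∫ g, Real.exp (-η * V ω g + (c - a) * r g) ∂μ) +
          ∫ g, Real.exp (β * V ω g - 2 * a * r g) ∂μ < 2 * N / δ := by
        refine (ENNReal.ofReal_lt_ofReal_iff (by positivity)).1 ?_
        rwa [ENNReal.ofReal_add hA0.le hB0.le,
          ofReal_integral_eq_lintegral_ofReal hAi (ae_of_all _ fun _ => (Real.exp_pos _).le),
          ofReal_integral_eq_lintegral_ofReal hBi (ae_of_all _ fun _ => (Real.exp_pos _).le)]
      obtain ⟨hint, hle⟩ := integrable_tilted_and_mul_integral_le hr hr0 (sub_pos.2 hac) (hη ω) hAi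
      refine ⟨hint, hle.trans ?_⟩
      -- The exponent -a r is the midpoint of -βV and βV - 2a r, so V drops out and N is traded for
      -- the partition function at β.
      have hcs := sq_integral_exp_le (w := fun g => -a * r g) (p := fun g => -β * V ω g)
        (q := fun g => β * V ω g - 2 * a * r g) (fun g => by ring) (hβ ω) hBi hN
      rw [← hNdef] at hcs
      have hZ0 := integral_exp_pos (hβ ω)
      set Z := ∫ g, Real.exp (-β * V ω g) ∂μ
      set A' := ∫ g, Real.exp (-η * V ω g + (c - a) * r g) ∂μ
      set B' := ∫ g, Real.exp (β * V ω g - 2 * a * r g) ∂μ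
      have hprod : A' * N ^ 2 ≤ Z * (N * (1 / δ)) ^ 2 := by
        have h1 : A' * B' ≤ (N * (1 / δ)) ^ 2 := by
          have : A' + B' ≤ 2 * (N * (1 / δ)) := by
            rw [mul_one_div, ← mul_div_assoc]; exact hsum.le
          nlinarith [sq_nonneg (A' - B')]
        calc A' * N ^ 2 ≤ A' * (Z * B') := by gcongr
          _ = Z * (A' * B') := by ring
          _ ≤ Z * (N * (1 / δ)) ^ 2 := by gcongr
      have hfinal : A' ≤ Z * (1 / δ) ^ 2 := by
        have hN2 : 0 < N ^ 2 := by positivity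
        refine le_of_mul_le_mul_right (hprod.trans_eq ?_) hN2
        ring
      have hlog := Real.log_le_log hA0 hfinal
      rw [Real.log_mul hZ0.ne' (by positivity), Real.log_pow] at hlog
      push_cast at hlog
      linarith

end PACBayes

end GPRegression

/-! ### Gaussian partition functions in the eigenbasis -/

namespace GPRegression

/-- The Gaussian integral of a squared exponential. -/
theorem integral_exp_neg_mul_sq_gaussianReal {v : ℝ≥0} (hv : v ≠ 0) {s : ℝ} (hs : 0 ≤ s) (w : ℝ) :
    ∫ z, Real.exp (-s * (z - w) ^ 2) ∂(gaussianReal 0 v) =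
      Real.exp (-(s * w ^ 2 / (1 + 2 * s * v)) - Real.log (1 + 2 * s * v) / 2) := by
  have hv0 : (0 : ℝ) < v := by exact_mod_cast pos_iff_ne_zero.2 hv
  have hd : 0 < 1 + 2 * s * (v : ℝ) := by positivity
  set d := 1 + 2 * s * (v : ℝ) with hdef
  -- Completing the square leaves a Gaussian density of variance v / d and mean 2svw / d.
  let v' : ℝ≥0 := ⟨v / d, by positivity⟩
  have hv'c : (v' : ℝ) = v / d := rfl
  have hv' : v' ≠ 0 := by
    rw [← NNReal.coe_ne_zero, hv'c]; positivity
  rw [integral_gaussianReal_eq_integral_smul hv]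
  have hpoint (z : ℝ) : gaussianPDFReal 0 v z • Real.exp (-s * (z - w) ^ 2) =
      Real.exp (-(s * w ^ 2 / d) - Real.log d / 2) *
        gaussianPDFReal (2 * s * v / d * w) v' z := by
    have hsqrt : (√(2 * Real.pi * v'))⁻¹ = (√(2 * Real.pi * v))⁻¹ * Real.exp (Real.log d / 2) := by
      rw [Real.exp_half, Real.exp_log hd, hv'c, ← mul_div_assoc, Real.sqrt_div (by positivity),
        inv_div, div_eq_inv_mul]
    rw [gaussianPDFReal_def, gaussianPDFReal_def, smul_eq_mul]
    simp only
    rw [hsqrt]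
    have hexp : Real.exp (-(z - 0) ^ 2 / (2 * v)) * Real.exp (-s * (z - w) ^ 2) =
        Real.exp (-(s * w ^ 2 / d) - Real.log d / 2) * (Real.exp (Real.log d / 2) *
          Real.exp (-(z - 2 * s * v / d * w) ^ 2 / (2 * v'))) := by
      rw [← Real.exp_add, ← Real.exp_add, ← Real.exp_add, hv'c]
      congr 1
      field_simp
      rw [hdef]
      ring
    rw [mul_assoc, hexp]
    ring
  simp_rw [hpoint]
  rw [integral_const_mul, integral_gaussianPDFReal_eq_one _ hv', mul_one]

variable {n : ℕ}

/-- In an eigenbasis of the covariance matrix, a centred Gaussian vector has independent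
coordinates whose variances are the eigenvalues. -/
theorem gpPrior_eq_map_pi {K : Matrix (Fin n) (Fin n) ℝ} (hK : K.PosDef) {α : ℝ} (hα : 0 < α) :
    gpPrior K α =
      (Measure.pi fun j => gaussianReal 0 (α * hK.1.eigenvalues j).toNNReal).map
        fun z => ∑ j, z j • hK.1.eigenvectorBasis j := by
  have hS : (α • K).PosSemidef := hK.posSemidef.smul hα.le
  unfold gpPrior
  have : IsProbabilityMeasure ((Measure.pi fun j =>
      gaussianReal 0 (α * hK.1.eigenvalues j).toNNReal).map
        fun z => ∑ j, z j • hK.1.eigenvectorBasis j) :=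
    Measure.isProbabilityMeasure_map (Measurable.aemeasurable (by fun_prop))
  apply Measure.ext_of_charFun
  ext t
  set b := hK.1.eigenvectorBasis
  rw [charFun_multivariateGaussian hS, charFun_apply,
    integral_map (Measurable.aemeasurable (by fun_prop))
      (Measurable.aestronglyMeasurable (by fun_prop))]
  simp_rw [sum_inner, Complex.ofReal_sum, Finset.sum_mul, Complex.exp_sum,
    integral_fintype_prod_eq_prod
      (f := fun i x => Complex.exp (inner ℝ ((x : ℝ) • b i) t * Complex.I)),
    real_inner_smul_left, mul_comm _ (inner ℝ (b _) t), Complex.ofReal_mul, ← charFun_apply_real,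
    charFun_gaussianReal, ← Complex.exp_sum]
  congr 1
  have hquad : t ⬝ᵥ (α • K) *ᵥ t = ∑ j, α * hK.1.eigenvalues j * inner ℝ (b j) t ^ 2 := by
    have hKt : K *ᵥ t = ∑ j, (hK.1.eigenvalues j * inner ℝ (b j) t) • (b j).ofLp := by
      conv_lhs => rw [← b.sum_repr' t]
      rw [WithLp.ofLp_sum, Matrix.mulVec_sum]
      refine Finset.sum_congr rfl fun j _ => ?_
      rw [WithLp.ofLp_smul, Matrix.mulVec_smul, hK.1.mulVec_eigenvectorBasis, smul_smul, mul_comm]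
    rw [Matrix.smul_mulVec, dotProduct_smul, hKt, dotProduct_sum, smul_eq_mul, Finset.mul_sum]
    refine Finset.sum_congr rfl fun j _ => ?_
    have : t.ofLp ⬝ᵥ (b j).ofLp = inner ℝ (b j) t := by
      simp [EuclideanSpace.inner_eq_star_dotProduct]
    rw [dotProduct_smul, this, smul_eq_mul]
    ring
  rw [hquad, inner_zero_right]
  push_cast
  simp only [mul_zero, zero_mul, zero_sub, Finset.sum_div, ← Finset.sum_neg_distrib]
  refine Finset.sum_congr rfl fun j _ => ?_
  rw [Real.coe_toNNReal _ (mul_nonneg hα.le (hK.eigenvalues_pos j).le)]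
  push_cast
  ring

/-- The information gain in terms of the eigenvalues. -/
theorem infoGain_eq_sum {K : Matrix (Fin n) (Fin n) ℝ} (hK : K.PosDef) {s : ℝ} (hs : 0 ≤ s) :
    infoGain K s = ∑ j, Real.log (1 + s * hK.1.eigenvalues j) / 2 := by
  have hdet : (s • K + 1).det = ∏ j, (1 + s * hK.1.eigenvalues j) := by
    have hspec := hK.1.spectral_theorem
    have : s • K + 1 = Unitary.conjStarAlgAut ℝ _ hK.1.eigenvectorUnitary
        (s • Matrix.diagonal (RCLike.ofReal ∘ hK.1.eigenvalues) + 1) := by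
      rw [map_add, map_smul, map_one, ← hspec]
    rw [this, Unitary.conjStarAlgAut_apply, Matrix.det_mul_right_comm]
    rw [← Matrix.diagonal_one, ← Matrix.diagonal_smul, Matrix.diagonal_add]
    simp [add_comm]
  rw [infoGain, hdet, Real.log_prod fun j _ => ?_, Finset.mul_sum]
  · exact Finset.sum_congr rfl fun j _ => by ring
  · have := hK.eigenvalues_pos j
    positivity

/-- The log-partition function of the Gibbs posterior. -/
theorem log_integral_exp_gpPrior {K : Matrix (Fin n) (Fin n) ℝ} (hK : K.PosDef) {α : ℝ}
    (hα : 0 < α) {s : ℝ} (hs : 0 ≤ s) (y : Fin n → ℝ) :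
    Real.log (∫ g, Real.exp (-s * ∑ i, (g i - y i) ^ 2) ∂(gpPrior K α)) =
      -infoGain K (2 * s * α) - ∑ j, s * inner ℝ (hK.1.eigenvectorBasis j) (WithLp.toLp 2 y) ^ 2 /
        (1 + 2 * s * (α * hK.1.eigenvalues j)) := by
  have hprior := gpPrior_eq_map_pi hK hα
  set b := hK.1.eigenvectorBasis
  have hpos (j : Fin n) : 0 < α * hK.1.eigenvalues j := mul_pos hα (hK.eigenvalues_pos j)
  have hsum (z : Fin n → ℝ) : ∑ i, ((∑ j, z j • b j) i - y i) ^ 2 =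
      ∑ j, (z j - inner ℝ (b j) (WithLp.toLp 2 y)) ^ 2 := by
    have h1 : ∑ i, ((∑ j, z j • b j) i - y i) ^ 2 =
        ‖(∑ j, z j • b j) - WithLp.toLp 2 y‖ ^ 2 := by
      rw [EuclideanSpace.real_norm_sq_eq]; rfl
    rw [h1, ← b.sum_sq_inner_right]
    refine Finset.sum_congr rfl fun j _ => ?_
    rw [inner_sub_right, b.orthonormal.inner_right_fintype]
  rw [hprior, integral_map (Measurable.aemeasurable (by fun_prop))
    (Measurable.aestronglyMeasurable (by fun_prop))]
  simp_rw [hsum, Finset.mul_sum, Real.exp_sum]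
  rw [integral_fintype_prod_eq_prod
    (f := fun j x => Real.exp (-s * (x - inner ℝ (b j) (WithLp.toLp 2 y)) ^ 2))]
  have hcoord (j : Fin n) := integral_exp_neg_mul_sq_gaussianReal
    (v := (α * hK.1.eigenvalues j).toNNReal) (by simpa using hpos j) hs
    (inner ℝ (b j) (WithLp.toLp 2 y))
  simp_rw [Real.coe_toNNReal _ (hpos _).le] at hcoord
  simp_rw [hcoord]
  rw [← Real.exp_sum, Real.log_exp, Finset.sum_sub_distrib, infoGain_eq_sum hK (by positivity),
    Finset.sum_neg_distrib]
  simp only [mul_assoc]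
  ring

end GPRegression

/-! ### RKHS norm, shrinkage inequality and noise moments -/

namespace GPRegression

/-- Bessel's inequality for the normalized feature vectors along an eigenbasis of the kernel
matrix. -/
theorem sum_sq_inner_div_eigenvalues_le {X H : Type*} [NormedAddCommGroup H]
    [InnerProductSpace ℝ H] [CompleteSpace H] [RKHS ℝ H X ℝ] {n : ℕ} {x : Fin n → X}
    (hK : (kernelMatrix H x).PosDef) (f : H) :
    ∑ j, inner ℝ (hK.1.eigenvectorBasis j) (WithLp.toLp 2 fun i => f (x i)) ^ 2 /
      hK.1.eigenvalues j ≤ ‖f‖ ^ 2 := by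
  set b := hK.1.eigenvectorBasis with hb
  -- By the reproducing property, these combinations of kernel sections are orthogonal with squared
  -- norms the eigenvalues, and their inner products with f are the eigenbasis coordinates of its
  -- sample vector.
  let h : Fin n → H := fun j => ∑ i, b j i • RKHS.kerFun H (x i) (1 : ℝ)
  have hker (i i' : Fin n) : inner ℝ (RKHS.kerFun H (x i) (1 : ℝ)) (RKHS.kerFun H (x i') (1 : ℝ)) =
      kernelMatrix H x i i' := by
    rw [RKHS.kerFun_inner, RKHS.kerFun_apply]
    simp [kernelMatrix, scalarKernel]
  have hh (j j' : Fin n) :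
      inner ℝ (h j) (h j') = hK.1.eigenvalues j' * if j = j' then 1 else 0 := by
    have h1 : inner ℝ (h j) (h j') = (b j).ofLp ⬝ᵥ (kernelMatrix H x *ᵥ (b j').ofLp) := by
      simp only [h, sum_inner, inner_sum, real_inner_smul_left, real_inner_smul_right, hker,
        dotProduct, Matrix.mulVec, Finset.mul_sum]
      rw [Finset.sum_comm]
      exact Finset.sum_congr rfl fun _ _ => Finset.sum_congr rfl fun _ _ => by ring
    rw [h1, hb, hK.1.mulVec_eigenvectorBasis, dotProduct_smul, smul_eq_mul,
      ← orthonormal_iff_ite.1 b.orthonormal j j', EuclideanSpace.inner_eq_star_dotProduct,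
      star_trivial, dotProduct_comm]
  have hhf (j : Fin n) : inner ℝ (h j) f = inner ℝ (b j) (WithLp.toLp 2 fun i => f (x i)) := by
    simp [h, sum_inner, real_inner_smul_left, PiLp.inner_apply, mul_comm]
  have hpos := hK.eigenvalues_pos
  have hortho : Orthonormal ℝ fun j => (√(hK.1.eigenvalues j))⁻¹ • h j := by
    rw [orthonormal_iff_ite]
    intro j j'
    rw [real_inner_smul_left, real_inner_smul_right, hh]
    split_ifs with hj
    · subst hj
      have := Real.mul_self_sqrt (hpos j).le
      have := (Real.sqrt_pos.2 (hpos j)).ne'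
      field_simp
      nlinarith
    · simp
  refine le_of_eq_of_le (Finset.sum_congr rfl fun j _ => ?_)
    (hortho.sum_inner_products_le (x := f) (s := Finset.univ))
  rw [real_inner_smul_left, hhf, Real.norm_eq_abs, sq_abs, mul_pow, inv_pow,
    Real.sq_sqrt (hpos j).le, div_eq_inv_mul]

/-- The scalar inequality behind the comparison of log-partition functions. -/
theorem shrinkage_sub_le {β η l : ℝ} (hβ : 0 < β) (hβη : β < η) (hl : 0 < l) (u e : ℝ) :
    η * (u + e) ^ 2 / (1 + 2 * η * l) - β * (u + e) ^ 2 / (1 + 2 * β * l) ≤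
      (η - β) * e ^ 2 + u ^ 2 / (2 * l) := by
  have hη : 0 < η := hβ.trans hβη
  have hd₁ : 0 < 1 + 2 * η * l := by positivity
  have hd₂ : 0 < 1 + 2 * β * l := by positivity
  set D := (1 + 2 * η * l) * (1 + 2 * β * l) with hD
  have hD1 : 1 + 2 * (η - β) * l ≤ D := by
    have : D = 1 + 2 * (η - β) * l + (4 * β * l + 4 * η * β * l ^ 2) := by rw [hD]; ring
    rw [this]
    have : 0 < 4 * β * l + 4 * η * β * l ^ 2 := by positivity
    linarith
  have hη_sub : 0 < η - β := sub_pos.2 hβη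
  have hleft : η * (u + e) ^ 2 / (1 + 2 * η * l) - β * (u + e) ^ 2 / (1 + 2 * β * l) =
      (η - β) * (u + e) ^ 2 / D := by
    rw [hD]; field_simp; ring
  have hDpos : 0 < D := mul_pos hd₁ hd₂
  rw [hleft, div_le_iff₀ hDpos]
  -- The weight for which u² / m, scaled by η - β, is exactly u² / (2l); the loss factor 1 + m is
  -- absorbed by `D`.
  set m := 2 * (η - β) * l with hm
  have hmpos : 0 < m := by positivity
  have hu : u ^ 2 / (2 * l) = (η - β) * (u ^ 2 / m) := by rw [hm]; field_simp
  have hsplit : (u + e) ^ 2 ≤ (e ^ 2 + u ^ 2 / m) * (1 + m) := by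
    have : (e ^ 2 + u ^ 2 / m) * (1 + m) - (u + e) ^ 2 = (u - m * e) ^ 2 / m := by
      field_simp; ring
    have : 0 ≤ (u - m * e) ^ 2 / m := by positivity
    linarith
  rw [hu, ← mul_add, mul_assoc]
  gcongr
  exact hsplit.trans (by gcongr)

/-- The moment generating function of a linear form in independent sub-Gaussian variables. -/
theorem lintegral_exp_sum_mul_le {Ω : Type*} [MeasurableSpace Ω] {P : Measure Ω}
    [IsProbabilityMeasure P] {n : ℕ} {ε : Fin n → Ω → ℝ} {σ : ℝ≥0}
    (hindep : iIndepFun ε P) (hsubG : ∀ i, HasSubgaussianMGF (ε i) (σ ^ 2) P) (u : Fin n → ℝ)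
    (t s : ℝ) :
    ∫⁻ ω, ENNReal.ofReal (Real.exp (t * ∑ i, u i * ε i ω + s)) ∂P ≤
      ENNReal.ofReal (Real.exp (σ ^ 2 * t ^ 2 / 2 * ∑ i, u i ^ 2 + s)) := by
  have hsum := HasSubgaussianMGF.sum_of_iIndepFun (s := Finset.univ)
    (X := fun i ω => u i * ε i ω)
    (hindep.comp (fun i z => u i * z) fun i => measurable_const_mul (u i))
    fun i _ => (hsubG i).const_mul (u i)
  have hmgf := hsum.mgf_le t
  have hint := hsum.integrable_exp_mul t
  simp_rw [Real.exp_add]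
  rw [← ofReal_integral_eq_lintegral_ofReal (hint.mul_const _)
    (ae_of_all _ fun _ => by positivity), integral_mul_const]
  refine ENNReal.ofReal_le_ofReal (mul_le_mul_of_nonneg_right ?_ (Real.exp_pos _).le)
  refine hmgf.trans_eq ?_
  have hcoe : ((∑ i, (NNReal.mk (u i ^ 2) (sq_nonneg (u i))) * σ ^ 2 : ℝ≥0) : ℝ) =
      σ ^ 2 * ∑ i, u i ^ 2 := by
    rw [NNReal.coe_sum, Finset.mul_sum]
    exact Finset.sum_congr rfl fun i _ => mul_comm _ _
  congr 1
  refine (congrArg (fun z : ℝ => z * t ^ 2 / 2) hcoe).trans ?_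
  ring

end GPRegression

/-! ### Comparison of partition functions at two temperatures -/

namespace GPRegression

variable {n : ℕ}

theorem integrable_exp_neg_mul_gpPrior (K : Matrix (Fin n) (Fin n) ℝ) (α : ℝ) {s : ℝ} (hs : 0 ≤ s)
    (y : Fin n → ℝ) (c : ℝ) :
    Integrable (fun g : EuclideanSpace ℝ (Fin n) => Real.exp (-s * (∑ i, (g i - y i) ^ 2 - c)))
      (gpPrior K α) := by
  have : IsProbabilityMeasure (gpPrior K α) := by unfold gpPrior; infer_instance
  refine Integrable.of_bound (C := Real.exp (s * c))
    (Continuous.aestronglyMeasurable (by fun_prop)) (ae_of_all _ fun g => ?_)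
  rw [Real.norm_eq_abs, abs_of_pos (Real.exp_pos _), Real.exp_le_exp]
  have : 0 ≤ s * ∑ i, (g i - y i) ^ 2 :=
    mul_nonneg hs (Finset.sum_nonneg fun i _ => sq_nonneg _)
  linarith

/-- The log-partition function after subtracting the constant `c` from the loss. -/
theorem log_integral_exp_sub_gpPrior {K : Matrix (Fin n) (Fin n) ℝ} {α s : ℝ} (hs : 0 ≤ s)
    (y : Fin n → ℝ) (c : ℝ) :
    Real.log (∫ g, Real.exp (-s * (∑ i, (g i - y i) ^ 2 - c)) ∂(gpPrior K α)) =
      Real.log (∫ g, Real.exp (-s * ∑ i, (g i - y i) ^ 2) ∂(gpPrior K α)) + s * c := by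
  have : IsProbabilityMeasure (gpPrior K α) := by unfold gpPrior; infer_instance
  have hint := integrable_exp_neg_mul_gpPrior K α hs y 0
  simp only [sub_zero] at hint
  have hexp (g : EuclideanSpace ℝ (Fin n)) : Real.exp (-s * (∑ i, (g i - y i) ^ 2 - c)) =
      Real.exp (-s * ∑ i, (g i - y i) ^ 2) * Real.exp (s * c) := by
    rw [← Real.exp_add]; congr 1; ring
  simp_rw [hexp]
  rw [integral_mul_const, Real.log_mul (integral_exp_pos hint).ne' (Real.exp_pos _).ne',
    Real.log_exp]

/-- Comparison of the log-partition functions at two inverse temperatures. -/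
theorem log_integral_exp_sub_le {X H : Type*} [NormedAddCommGroup H]
    [InnerProductSpace ℝ H] [CompleteSpace H] [RKHS ℝ H X ℝ] {x : Fin n → X}
    (hK : (kernelMatrix H x).PosDef) (f : H) (e : Fin n → ℝ) {α β η : ℝ} (hα : 0 < α) (hβ : 0 < β)
    (hβη : β < η) :
    Real.log (∫ g, Real.exp (-β * (∑ i, (g i - (f (x i) + e i)) ^ 2 - ∑ i, e i ^ 2))
        ∂(gpPrior (kernelMatrix H x) α)) -
      Real.log (∫ g, Real.exp (-η * (∑ i, (g i - (f (x i) + e i)) ^ 2 - ∑ i, e i ^ 2))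
        ∂(gpPrior (kernelMatrix H x) α)) ≤
      relInfoGain (kernelMatrix H x) (2 * η * α) (2 * β * α) + 1 / (2 * α) * ‖f‖ ^ 2 := by
  have hη : 0 < η := hβ.trans hβη
  rw [log_integral_exp_sub_gpPrior hβ.le, log_integral_exp_sub_gpPrior hη.le,
    log_integral_exp_gpPrior hK hα hβ.le, log_integral_exp_gpPrior hK hα hη.le, relInfoGain]
  have hbessel := sum_sq_inner_div_eigenvalues_le hK f
  have hpos := hK.eigenvalues_pos
  set b := hK.1.eigenvectorBasis
  have hadd : WithLp.toLp 2 (fun i => f (x i) + e i) =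
      WithLp.toLp 2 (fun i => f (x i)) + WithLp.toLp 2 e := rfl
  -- By Parseval, the noise part of the shrinkage bound is exactly offset by the constant subtracted
  -- from the loss.
  have hnorm : ∑ i, e i ^ 2 = ∑ j, inner ℝ (b j) (WithLp.toLp 2 e) ^ 2 := by
    rw [b.sum_sq_inner_right, EuclideanSpace.real_norm_sq_eq]
  have hterm := Finset.sum_le_sum fun j (_ : j ∈ Finset.univ) =>
    shrinkage_sub_le hβ hβη (mul_pos hα (hpos j))
      (inner ℝ (b j) (WithLp.toLp 2 fun i => f (x i))) (inner ℝ (b j) (WithLp.toLp 2 e))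
  rw [Finset.sum_sub_distrib, Finset.sum_add_distrib, ← Finset.mul_sum, ← hnorm] at hterm
  have hscale : ∑ j, inner ℝ (b j) (WithLp.toLp 2 fun i => f (x i)) ^ 2 /
      (2 * (α * hK.1.eigenvalues j)) = 1 / (2 * α) *
        ∑ j, inner ℝ (b j) (WithLp.toLp 2 fun i => f (x i)) ^ 2 / hK.1.eigenvalues j := by
    rw [Finset.mul_sum]
    refine Finset.sum_congr rfl fun j _ => ?_
    have := (hpos j).ne'
    field_simp
  have hbessel' := mul_le_mul_of_nonneg_left hbessel (by positivity : 0 ≤ 1 / (2 * α))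
  simp only [hadd, inner_add_right]
  linarith

theorem relInfoGain_nonneg {K : Matrix (Fin n) (Fin n) ℝ} (hK : K.PosDef) {s t : ℝ} (ht : 0 ≤ t)
    (hts : t ≤ s) : 0 ≤ relInfoGain K s t := by
  rw [relInfoGain, infoGain_eq_sum hK (ht.trans hts), infoGain_eq_sum hK ht, sub_nonneg]
  refine Finset.sum_le_sum fun j _ => ?_
  have := hK.eigenvalues_pos j
  gcongr

/-- Normalization absorbs constants, so the loss may be centred by a noise-dependent quantity. -/
theorem gibbsPosterior_eq_tilted_sub (K : Matrix (Fin n) (Fin n) ℝ) (y : Fin n → ℝ) {η : ℝ}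
    (hη : 0 ≤ η) (α c : ℝ) :
    gibbsPosterior K y η α =
      (gpPrior K α).tilted fun g => -η * (∑ i, (g i - y i) ^ 2 - c) := by
  have : IsProbabilityMeasure (gpPrior K α) := by unfold gpPrior; infer_instance
  have hint := integrable_exp_neg_mul_gpPrior K α hη y 0
  simp only [sub_zero] at hint
  have := isProbabilityMeasure_gibbsPosterior K y hη α
  rw [← tilted_const (gibbsPosterior K y η α) (η * c), gibbsPosterior, tilted_tilted hint]
  congr 1
  ext g
  simp only [Pi.add_apply]
  ring

end GPRegression

/-! ### Assembly of the excess risk bound -/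

theorem mainTheorem1
    {X : Type*} {H : Type*} [NormedAddCommGroup H] [InnerProductSpace ℝ H] [CompleteSpace H]
    [RKHS ℝ H X ℝ]
    {Ω : Type*} [MeasurableSpace Ω] (P : Measure Ω) [IsProbabilityMeasure P]
    (n : ℕ) (hn : 1 ≤ n) (x : Fin n → X) (fstar : H)
    (σ : ℝ≥0) (ε : Fin n → Ω → ℝ)
    (hεmeas : ∀ i, Measurable (ε i))
    (hεindep : iIndepFun ε P)
    (hεsubG : ∀ i, HasSubgaussianMGF (ε i) (σ ^ 2) P)
    (hK : (GPRegression.kernelMatrix H x).PosDef)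
    (δ : ℝ) (hδ0 : 0 < δ) (hδ1 : δ ≤ 1)
    (η : ℝ) (hη0 : 0 < η) (hη1 : 2 * (σ : ℝ) ^ 2 * η < 1)
    (β : ℝ) (hβ0 : 0 < β)
    (hηβ : 0 < η - 2 * η ^ 2 * (σ : ℝ) ^ 2 - β - 2 * β ^ 2 * (σ : ℝ) ^ 2)
    (α : ℝ) (hα : 0 < α) :
    ENNReal.ofReal (1 - δ) ≤ P {ω |
      Integrable (GPRegression.excessRisk fun i => fstar (x i))
        (GPRegression.gibbsPosterior (GPRegression.kernelMatrix H x)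
          (fun i => fstar (x i) + ε i ω) η α) ∧
      ∫ g, GPRegression.excessRisk (fun i => fstar (x i)) g
        ∂(GPRegression.gibbsPosterior (GPRegression.kernelMatrix H x)
          (fun i => fstar (x i) + ε i ω) η α)
        ≤ (2 * GPRegression.relInfoGain (GPRegression.kernelMatrix H x) (2 * η * α) (2 * β * α)
            + 1 / (2 * α) * ‖fstar‖ ^ 2 + 2 * Real.log (1 / δ))
          / (n * (η - 2 * (σ : ℝ) ^ 2 * η ^ 2 - β - 2 * (σ : ℝ) ^ 2 * β ^ 2))} := by

  have hβη : β < η := by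
    have h1 : 0 ≤ 2 * η ^ 2 * (σ : ℝ) ^ 2 := by positivity
    have h2 : 0 ≤ 2 * β ^ 2 * (σ : ℝ) ^ 2 := by positivity
    linarith
  set K := GPRegression.kernelMatrix H x with hKdef
  set f : Fin n → ℝ := fun i => fstar (x i) with hf
  have hprior : IsProbabilityMeasure (GPRegression.gpPrior K α) := by
    unfold GPRegression.gpPrior; infer_instance
  let r : EuclideanSpace ℝ (Fin n) → ℝ := fun g => ∑ i, (g i - f i) ^ 2
  -- Removing the squared noise leaves only a linear noise term; squares would need more than the
  -- sub-Gaussian moment bound.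
  let V : Ω → EuclideanSpace ℝ (Fin n) → ℝ :=
    fun ω g => ∑ i, (g i - (f i + ε i ω)) ^ 2 - ∑ i, ε i ω ^ 2
  have hVr (ω : Ω) (g : EuclideanSpace ℝ (Fin n)) :
      V ω g = r g - 2 * ∑ i, (g i - f i) * ε i ω := by
    simp only [V, r, Finset.mul_sum, ← Finset.sum_sub_distrib]
    exact Finset.sum_congr rfl fun i _ => by ring
  have hVmeas : Measurable (Function.uncurry V) := by
    unfold V Function.uncurry
    fun_prop
  have hrmeas : Measurable r := by unfold r; fun_prop
  have hr0 (g : EuclideanSpace ℝ (Fin n)) : 0 ≤ r g :=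
    Finset.sum_nonneg fun i _ => sq_nonneg _
  have hmgf (g : EuclideanSpace ℝ (Fin n)) (t s : ℝ) :=
    GPRegression.lintegral_exp_sum_mul_le hεindep hεsubG (fun i => g i - f i) t s
  have hbound := GPRegression.ofReal_le_measure_localized_pacBayes
    (μ := GPRegression.gpPrior K α) (P := P) (η := η) (β := β)
    -- With t = 2η and t = -2β, the noise costs σ²t²/2 = 2σ²η² and 2σ²β² per unit of r; these `a`
    -- and `c` bring both moments to exp(-a r).
    (a := β + 2 * β ^ 2 * (σ : ℝ) ^ 2) (c := η - 2 * η ^ 2 * (σ : ℝ) ^ 2)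
    hVmeas hrmeas hr0 (by positivity) (by linarith) hδ0
    (fun ω => GPRegression.integrable_exp_neg_mul_gpPrior K α hη0.le _ _)
    (fun ω => GPRegression.integrable_exp_neg_mul_gpPrior K α hβ0.le _ _)
    (fun g => by
      refine le_of_eq_of_le (lintegral_congr fun ω => ?_) ((hmgf g (2 * η)
        (-(2 * η ^ 2 * (σ : ℝ) ^ 2 + β + 2 * β ^ 2 * (σ : ℝ) ^ 2) * r g)).trans_eq ?_)
      · rw [hVr]; congr 2; ring
      · congr 2; simp only [r]; ring)
    (fun g => by
      refine le_of_eq_of_le (lintegral_congr fun ω => ?_) ((hmgf g (-(2 * β))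
        (-(β + 4 * β ^ 2 * (σ : ℝ) ^ 2) * r g)).trans_eq ?_)
      · rw [hVr]; congr 2; ring
      · congr 2; simp only [r]; ring)
  refine hbound.trans (measure_mono fun ω hω => ?_)
  simp only [Set.mem_ofPred_eq] at hω ⊢
  rw [← GPRegression.gibbsPosterior_eq_tilted_sub K (fun i => f i + ε i ω) hη0.le α] at hω
  obtain ⟨hint, hle⟩ := hω
  have hrisk : GPRegression.excessRisk f = fun g => 1 / (n : ℝ) * r g := by
    ext g
    rw [GPRegression.excessRisk, EuclideanSpace.real_norm_sq_eq]
    rfl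
  rw [hrisk]
  refine ⟨hint.const_mul _, ?_⟩
  have hn0 : (0 : ℝ) < n := by exact_mod_cast hn
  have hden : 0 < η - 2 * (σ : ℝ) ^ 2 * η ^ 2 - β - 2 * (σ : ℝ) ^ 2 * β ^ 2 := by linarith
  have hlog := GPRegression.log_integral_exp_sub_le hK fstar (fun i => ε i ω) hα hβ0 hβη
  -- The argument yields a single relative gain; nonnegativity gives the stated factor 2.
  have hgain := GPRegression.relInfoGain_nonneg hK (s := 2 * η * α) (t := 2 * β * α)
    (by positivity) (by gcongr)
  rw [integral_const_mul, le_div_iff₀ (mul_pos hn0 hden)]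
  refine le_of_eq_of_le ?_ (hle.trans (add_le_add_left (hlog.trans ?_) _))
  · field_simp
    ring
  · linarith
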